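/- Let $L$ be a finite-dimensional Lie algebra over a field $F$. For a Lie algebra $U$ over $F$ let $N(U)$ be its nilradical (largest nilpotent ideal) and $R(U)$ its solvable radical. The nilpotency class of a nilpotent Lie algebra $N$ is the least $n\ge 0$ with $N^{n+1}=0$, where $N^1=N$ and $N^{k+1}=[N^k,N]$. Call $U$ *nilregular* if $F$ has characteristic $0$, or if $F$ has characteristic $p>0$ and $N(U)$ has nilpotency class less than $p-1$; call $U$ *solregular* if $F$ has characteristic $0$, or if $F$ has characteristic $p>0$ and $R(U)$ has derived length less than $\log_2 p$; call $U$ *irregular* if it is neither nilregular nor solregular. A minimal ideal of $L$ is a minimal element of the set of nonzero ideals of $L$. (a) Let $I$ be a minimal ideal of $L$ that is non-abelian. Then either (i) $I$ is a simple Lie algebra, or (ii) $F$ has characteristic $p>0$, the nilradical $N(I)$ has nilpotency class greater than or equal to $p-1$, and the solvable radical $R(I)$ has derived length greater than or equal to $\log_2 p$. (b) Consequently, every minimal ideal of $L$ is abelian, simple or irregular. -/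

import Mathlib

namespace RegularLie

section

variable (F U : Type*) [Field F] [LieRing U] [LieAlgebra F U]

/-- The nilradical `N(U)` of a Lie algebra: the sum of all ideals of `U` that are nilpotent as Lie
algebras. For finite-dimensional `U` this is the largest nilpotent ideal.

Mathlib's `LieAlgebra.maxNilpotentIdeal` is a different ideal: it is built from the ideals on which
the whole of `U` acts nilpotently. -/
def nilradical : LieIdeal F U :=
  sSup {J : LieIdeal F U | LieRing.IsNilpotent J}

/-- The nilpotency class of the nilradical `N(U)`: the number `n` with `N ^ (n + 1) = 0` and
`N ^ n ≠ 0` (if `n ≠ 0`), where `N ^ 1 = N`, `N ^ (k + 1) = [N ^ k, N]`; the zero algebra has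
class `0`. In Mathlib's indexing the lower central series starts at `0`, that is, its `k`-th term
is `N ^ (k + 1)`. -/
noncomputable def nilradicalClass : ℕ :=
  LieModule.nilpotencyLength (nilradical F U) (nilradical F U)

/-- The derived length of the solvable radical `R(U)`. -/
noncomputable def radicalDerivedLength : ℕ :=
  LieAlgebra.derivedLength F (LieAlgebra.radical F U)

/-- `U` is nilregular: `F` has characteristic zero, or `F` has characteristic `p > 0` and the
nilradical of `U` has nilpotency class less than `p - 1`. -/
def Nilregular : Prop :=
  CharZero F ∨ ∃ p : ℕ, p.Prime ∧ CharP F p ∧ nilradicalClass F U < p - 1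

/-- `U` is solregular: `F` has characteristic zero, or `F` has characteristic `p > 0` and the
solvable radical of `U` has derived length less than `log₂ p`. -/
def Solregular : Prop :=
  CharZero F ∨
    ∃ p : ℕ, p.Prime ∧ CharP F p ∧ (radicalDerivedLength F U : ℝ) < Real.logb 2 (p : ℝ)

/-- `U` is regular if it is nilregular or solregular. -/
def Regular : Prop :=
  Nilregular F U ∨ Solregular F U

/-- `U` is irregular if it is not regular. -/
def Irregular : Prop :=
  ¬ Regular F U

end

end RegularLie

/-! Elements of `L` act on a minimal ideal `I` by derivations, so a derivation-invariant ideal of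
`I` is an ideal of `L`, hence `0` or `I`. For non-abelian `I` this excludes solvability. If the
nilradical or the radical of `I` is derivation-invariant, it is therefore zero and `I` has no
nonzero abelian ideal. A minimal ideal `J` of `I` then satisfies `[J, J] = J`, and a perfect ideal
is derivation-invariant, so `J = I` and `I` is simple.

The invariance comes from showing that `N + D(N)` is again nilpotent (`isNilpotent_derivSup`) or
solvable (`isSolvable_derivSup`). Powers of `D` are applied to a bracket that vanishes, or lies deep
in the derived series; by Leibniz the surviving terms are brackets of elements `D x` with a
factorial or binomial coefficient. It suffices to invert `(n + 1)!` for class `n`, or `(2 ^ d)!` for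
derived length `d`; in characteristic `p` this means `n < p - 1` or `2 ^ d < p`. -/

namespace RegularLie

/-! ### Lower central series, Fitting's theorem and the ideal N + D(N) -/

section Derivation

variable {F L : Type*} [Field F] [LieRing L] [LieAlgebra F L]

/-- The lower central series of an ideal `N`, as a sequence of ideals of the ambient algebra. -/
def selfLcs (N : LieIdeal F L) : ℕ → LieIdeal F L
  | 0 => N
  | k + 1 => ⁅N, selfLcs N k⁆

theorem exists_mem_lowerCentralSeries_of_mem_selfLcs (N : LieIdeal F L) (k : ℕ) :
    ∀ v ∈ selfLcs N k, ∃ h : v ∈ N, (⟨v, h⟩ : N) ∈ LieModule.lowerCentralSeries F N N k := by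
  induction k with
  | zero => exact fun v hv => ⟨hv, by simp⟩
  | succ k ih =>
    intro v hv
    rw [selfLcs, ← LieSubmodule.mem_toSubmodule, LieSubmodule.lieIdeal_oper_eq_linear_span'] at hv
    induction hv using Submodule.span_induction with
    | mem w hw =>
      obtain ⟨a, ha, b, hb, rfl⟩ := hw
      obtain ⟨hbN, hb'⟩ := ih b hb
      refine ⟨lie_mem_left F L N a b ha, ?_⟩
      rw [LieModule.lowerCentralSeries_succ]
      exact LieSubmodule.lie_mem_lie (LieSubmodule.mem_top (⟨a, ha⟩ : N)) hb'
    | zero => exact ⟨N.zero_mem, LieSubmodule.zero_mem _⟩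
    | add x y _ _ hx hy =>
      obtain ⟨hx, hx'⟩ := hx
      obtain ⟨hy, hy'⟩ := hy
      exact ⟨N.add_mem hx hy, add_mem hx' hy'⟩
    | smul c x _ hx =>
      obtain ⟨hx, hx'⟩ := hx
      exact ⟨N.smul_mem c hx, SMulMemClass.smul_mem c hx'⟩

theorem selfLcs_eq_bot {N : LieIdeal F L} {k : ℕ}
    (h : LieModule.lowerCentralSeries F N N k = ⊥) : selfLcs N k = ⊥ := by
  rw [eq_bot_iff]
  intro v hv
  obtain ⟨hN, hv'⟩ := exists_mem_lowerCentralSeries_of_mem_selfLcs N k v hv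
  rw [h, LieSubmodule.mem_bot] at hv'
  simpa using congrArg Subtype.val hv'

theorem exists_selfLcs_eq_bot (N : LieIdeal F L) [LieRing.IsNilpotent N] :
    ∃ k, selfLcs N k = ⊥ :=
  (LieModule.IsNilpotent.nilpotent F N N).imp fun _ => selfLcs_eq_bot

theorem lcs_succ_le_selfLcs (N : LieIdeal F L) (k : ℕ) : N.lcs L (k + 1) ≤ selfLcs N k := by
  induction k with
  | zero => simpa [selfLcs] using LieSubmodule.lie_le_left _ _
  | succ k ih =>
    rw [LieIdeal.lcs_succ]
    exact LieSubmodule.mono_lie le_rfl ih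

theorem exists_lcs_eq_bot (N : LieIdeal F L) [LieRing.IsNilpotent N] :
    ∃ k, N.lcs L k = ⊥ := by
  obtain ⟨k, hk⟩ := exists_selfLcs_eq_bot N
  exact ⟨k + 1, eq_bot_iff.2 (hk ▸ lcs_succ_le_selfLcs N k)⟩

theorem isNilpotent_of_lcs_eq_bot {N : LieIdeal F L} {k : ℕ} (h : N.lcs L k = ⊥) :
    LieRing.IsNilpotent N := by
  have : LieModule.IsNilpotent N L := by
    refine (LieModule.isNilpotent_iff F N L).2 ⟨k, ?_⟩
    rw [← LieSubmodule.toSubmodule_inj, ← LieIdeal.coe_lcs_eq, h]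
    simp
  exact Function.Injective.lieModuleIsNilpotent (R := F) (f := (LieHom.id : N →ₗ⁅F⁆ N))
    (g := N.toSubmodule.subtype) (fun _ _ => rfl) N.toSubmodule.injective_subtype

theorem lcs_antitone (N : LieIdeal F L) : Antitone (N.lcs L) :=
  antitone_nat_of_succ_le fun k => by
    rw [LieIdeal.lcs_succ]
    exact LieSubmodule.lie_le_right _ _

theorem lie_iSup_le {ι : Sort*} {N K : LieIdeal F L} {f : ι → LieIdeal F L}
    (h : ∀ i, ⁅N, f i⁆ ≤ K) : ⁅N, ⨆ i, f i⁆ ≤ K := by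
  refine (LieSubmodule.lie_le_iff _ _ _).2 fun x hx m hm => ?_
  induction hm using LieSubmodule.iSup_induction' with
  | mem i y hy => exact h i (LieSubmodule.lie_mem_lie hx hy)
  | zero => simp
  | add y z _ _ hy hz => simpa using add_mem hy hz

/-- A bracket with `m` factors from `N₁` or `N₂` has `i` from `N₁` and `m - i` from `N₂`; as both
are ideals, it lies in both corresponding terms. -/
theorem lcs_sup_le (N₁ N₂ : LieIdeal F L) (m : ℕ) :
    (N₁ ⊔ N₂).lcs L m ≤ ⨆ p ∈ Finset.HasAntidiagonal.antidiagonal m, N₁.lcs L p.1 ⊓ N₂.lcs L p.2 := by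
  induction m with
  | zero => simp
  | succ m ih =>
    rw [LieIdeal.lcs_succ]
    refine (LieSubmodule.mono_lie le_rfl ih).trans ?_
    refine lie_iSup_le fun p => lie_iSup_le fun hp => ?_
    rw [Finset.HasAntidiagonal.mem_antidiagonal] at hp
    rw [LieSubmodule.sup_lie]
    refine sup_le ?_ ?_
    · refine le_trans ?_ (le_iSup₂_of_le (p.1 + 1, p.2)
        (by rw [Finset.HasAntidiagonal.mem_antidiagonal]; simp only; lia) le_rfl)
      refine le_inf ?_ ((LieSubmodule.lie_le_right _ _).trans inf_le_right)
      rw [LieIdeal.lcs_succ]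
      exact LieSubmodule.mono_lie le_rfl inf_le_left
    · refine le_trans ?_ (le_iSup₂_of_le (p.1, p.2 + 1)
        (by rw [Finset.HasAntidiagonal.mem_antidiagonal]; simp only; lia) le_rfl)
      refine le_inf ((LieSubmodule.lie_le_right _ _).trans inf_le_left) ?_
      rw [LieIdeal.lcs_succ]
      exact LieSubmodule.mono_lie le_rfl inf_le_right

/-- Fitting's theorem: the sum of two nilpotent ideals is nilpotent. -/
theorem isNilpotent_sup {N₁ N₂ : LieIdeal F L} (h₁ : LieRing.IsNilpotent N₁)
    (h₂ : LieRing.IsNilpotent N₂) : LieRing.IsNilpotent ↥(N₁ ⊔ N₂) := by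
  obtain ⟨k, hk⟩ := exists_lcs_eq_bot N₁
  obtain ⟨l, hl⟩ := exists_lcs_eq_bot N₂
  refine isNilpotent_of_lcs_eq_bot (k := k + l) (eq_bot_iff.2 ((lcs_sup_le _ _ _).trans ?_))
  refine iSup₂_le fun p hp => ?_
  rw [Finset.HasAntidiagonal.mem_antidiagonal] at hp
  rcases le_or_gt k p.1 with h | h
  · exact inf_le_left.trans ((lcs_antitone N₁ h).trans hk.le)
  · exact inf_le_right.trans ((lcs_antitone N₂ (by lia)).trans hl.le)

theorem isNilpotent_nilradical [FiniteDimensional F L] :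
    LieRing.IsNilpotent (nilradical F L) := by
  have hwf := LieSubmodule.wellFoundedGT_of_noetherian F L L
  -- In a Noetherian lattice a nonempty set closed under binary joins contains its supremum.
  refine CompleteLattice.WellFoundedGT.isSupClosedCompact _ hwf
    {J : LieIdeal F L | LieRing.IsNilpotent J} ⟨⊥, ?_⟩ fun N₁ h₁ N₂ h₂ => isNilpotent_sup h₁ h₂
  exact isNilpotent_of_lcs_eq_bot (k := 1) (by simp [LieIdeal.lcs_succ])

theorem le_nilradical {J : LieIdeal F L} (h : LieRing.IsNilpotent J) : J ≤ nilradical F L :=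
  le_sSup h

/-- The ideal `N + D(N)` for a derivation `D`. -/
def derivSup (N : LieIdeal F L) (D : LieDerivation F L L) : LieIdeal F L where
  toSubmodule := N.toSubmodule ⊔ N.toSubmodule.map (D : L →ₗ[F] L)
  lie_mem := by
    intro l m hm
    obtain ⟨a, ha, b, ⟨c, hc, rfl⟩, rfl⟩ := Submodule.mem_sup.1 hm
    have h : ⁅l, a + D c⁆ = (⁅l, a⁆ - ⁅D l, c⁆) + D ⁅l, c⁆ := by
      rw [LieDerivation.apply_lie_eq_add, lie_add]
      abel
    change ⁅l, a + D c⁆ ∈ _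
    rw [h]
    exact Submodule.add_mem_sup
      (sub_mem (lie_mem_right F L N l a ha) (lie_mem_right F L N (D l) c hc))
      (Submodule.mem_map_of_mem (lie_mem_right F L N l c hc))

theorem mem_derivSup {N : LieIdeal F L} {D : LieDerivation F L L} {v : L} :
    v ∈ derivSup N D ↔ ∃ a ∈ N, ∃ b ∈ N, a + D b = v := by
  refine Submodule.mem_sup.trans ?_
  simp

theorem apply_mem_derivSup {N : LieIdeal F L} (D : LieDerivation F L L) {v : L} (hv : v ∈ N) :
    D v ∈ derivSup N D :=
  mem_derivSup.2 ⟨0, N.zero_mem, v, hv, by simp⟩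

theorem mem_of_natCast_nsmul_mem {K : LieIdeal F L} {n : ℕ} (hn : (n : F) ≠ 0) {v : L}
    (h : n • v ∈ K) : v ∈ K := by
  rw [← Nat.cast_smul_eq_nsmul F] at h
  simpa [smul_smul, hn] using K.smul_mem (n : F)⁻¹ h

theorem nsmul_mem_lieIdeal {K : LieIdeal F L} (n : ℕ) {v : L} (h : v ∈ K) : n • v ∈ K :=
  K.toSubmodule.nsmul_mem h n

theorem ad_pow_mem (K : LieIdeal F L) (y : L) (k : ℕ) {v : L} (h : v ∈ K) :
    (LieAlgebra.ad F L y ^ k) v ∈ K := by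
  induction k with
  | zero => simpa
  | succ k ih =>
    rw [pow_succ', Module.End.mul_apply, LieAlgebra.ad_apply]
    exact lie_mem_right F L K y _ ih

theorem ad_pow_mem_of_le {K : LieIdeal F L} {y v : L} {k l : ℕ} (hkl : k ≤ l)
    (h : (LieAlgebra.ad F L y ^ k) v ∈ K) : (LieAlgebra.ad F L y ^ l) v ∈ K := by
  obtain ⟨m, rfl⟩ := Nat.exists_eq_add_of_le' hkl
  rw [pow_add, Module.End.mul_apply]
  exact ad_pow_mem K y m h

theorem ad_pow_mem_selfLcs {N : LieIdeal F L} {x z : L} (hx : x ∈ N) (hz : z ∈ N) (k : ℕ) :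
    (LieAlgebra.ad F L x ^ k) z ∈ selfLcs N k := by
  induction k with
  | zero => simpa [selfLcs]
  | succ k ih =>
    rw [pow_succ', Module.End.mul_apply, LieAlgebra.ad_apply, selfLcs]
    exact LieSubmodule.lie_mem_lie hx ih

end Derivation

/-! ### Leibniz expansions modulo N and [N, N] -/

section Leibniz

variable {F L : Type*} [Field F] [LieRing L] [LieAlgebra F L]

/-- The leading term, modulo `⁅N, N⁆`, of `D ^ m` applied to `(ad x) ^ m z`, divided by `m !`. -/
def leadingTerm (D : LieDerivation F L L) (x z : L) : ℕ → L
  | 0 => z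
  | m + 1 => ⁅D x, leadingTerm D x z m⁆ + ⁅x, (LieAlgebra.ad F L (D x) ^ m) (D z)⁆

theorem leadingTerm_mem {N : LieIdeal F L} (D : LieDerivation F L L) {x z : L} (hx : x ∈ N)
    (hz : z ∈ N) (m : ℕ) : leadingTerm D x z m ∈ N := by
  induction m with
  | zero => exact hz
  | succ m ih => exact add_mem (lie_mem_right F L N _ _ ih) (lie_mem_left F L N _ _ hx)

/-- The bracket has `m + 1` factors in `N`. Fewer than `m` copies of `D` leave two untouched. With
`m` copies, modulo `[N, N]`, exactly one stays untouched and the others are hit once, in `m!`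
orders. With `m + 1` copies, modulo `N`, each factor is hit once. -/
theorem iterate_apply_sub_leadingTerm_mem {N : LieIdeal F L} (D : LieDerivation F L L) {x z : L}
    (hx : x ∈ N) (hz : z ∈ N) (m : ℕ) :
    (∀ j < m, D^[j] ((LieAlgebra.ad F L x ^ m) z) ∈ ⁅N, N⁆) ∧
    D^[m] ((LieAlgebra.ad F L x ^ m) z) - m.factorial • leadingTerm D x z m ∈ ⁅N, N⁆ ∧
    D^[m + 1] ((LieAlgebra.ad F L x ^ m) z) -
      (m + 1).factorial • (LieAlgebra.ad F L (D x) ^ m) (D z) ∈ N := by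
  induction m with
  | zero => simp [leadingTerm]
  | succ m ih =>
    obtain ⟨h₁, h₂, h₃⟩ := ih
    set P := (LieAlgebra.ad F L x ^ m) z with hP
    have hNN : ⁅N, N⁆ ≤ N := LieSubmodule.lie_le_right _ _
    have hm : D^[m] P ∈ N := by
      have := add_mem (hNN h₂) (nsmul_mem_lieIdeal m.factorial (leadingTerm_mem D hx hz m))
      simpa using this
    have hle : ∀ j ≤ m, D^[j] P ∈ N := fun j hj => by
      rcases hj.lt_or_eq with h | rfl
      · exact hNN (h₁ j h)
      · exact hm
    have hPs : (LieAlgebra.ad F L x ^ (m + 1)) z = ⁅x, P⁆ := by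
      rw [pow_succ', Module.End.mul_apply, LieAlgebra.ad_apply]
    rw [hPs]
    refine ⟨fun j hj => ?_, ?_, ?_⟩
    · rw [LieDerivation.iterate_apply_lie']
      refine sum_mem fun i hi => nsmul_mem_lieIdeal _ ?_
      rw [Finset.mem_range] at hi
      rcases Nat.eq_zero_or_pos i with rfl | hi'
      · exact LieSubmodule.lie_mem_lie hx (hle _ (by lia))
      · exact lie_mem_right F L ⁅N, N⁆ _ _ (h₁ _ (by lia))
    · rw [LieDerivation.iterate_apply_lie', Finset.sum_range_succ', Finset.sum_range_succ']
      have hrest : ∑ i ∈ Finset.range m, (m + 1).choose (i + 1 + 1) •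
          ⁅D^[i + 1 + 1] x, D^[m + 1 - (i + 1 + 1)] P⁆ ∈ ⁅N, N⁆ := by
        refine sum_mem fun i hi => nsmul_mem_lieIdeal _ ?_
        rw [Finset.mem_range] at hi
        exact lie_mem_right F L ⁅N, N⁆ _ _ (h₁ _ (by lia))
      have e₁ : ⁅x, D^[m + 1] P -
          (m + 1).factorial • (LieAlgebra.ad F L (D x) ^ m) (D z)⁆ ∈ ⁅N, N⁆ :=
        LieSubmodule.lie_mem_lie hx h₃
      have e₂ := nsmul_mem_lieIdeal (m + 1) (lie_mem_right F L ⁅N, N⁆ (D x) _ h₂)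
      have := add_mem (add_mem hrest e₂) e₁
      convert this using 1
      simp only [leadingTerm, lie_sub, lie_nsmul, smul_sub, smul_add, smul_smul,
        Nat.factorial_succ, zero_add, Nat.choose_one_right, Nat.choose_zero_right, one_smul,
        Function.iterate_one, Function.iterate_zero, id, Nat.add_sub_cancel, Nat.sub_zero]
      abel
    · rw [LieDerivation.iterate_apply_lie', Finset.sum_range_succ', Finset.sum_range_succ']
      have hrest : ∑ i ∈ Finset.range (m + 1), (m + 1 + 1).choose (i + 1 + 1) •
          ⁅D^[i + 1 + 1] x, D^[m + 1 + 1 - (i + 1 + 1)] P⁆ ∈ N := by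
        refine sum_mem fun i hi => nsmul_mem_lieIdeal _ ?_
        rw [Finset.mem_range] at hi
        exact lie_mem_right F L N _ _ (hle _ (by lia))
      have e₁ : ⁅x, D^[m + 1 + 1] P⁆ ∈ N := lie_mem_left F L N _ _ hx
      have e₂ := nsmul_mem_lieIdeal (m + 1 + 1) (lie_mem_right F L N (D x) _ h₃)
      have := add_mem (add_mem hrest e₂) e₁
      convert this using 1
      simp only [lie_sub, lie_nsmul, smul_sub, smul_smul, pow_succ' _ m, Module.End.mul_apply,
        LieAlgebra.ad_apply, Nat.factorial_succ (m + 1), zero_add, Nat.choose_one_right,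
        Nat.choose_zero_right, one_smul,
        Function.iterate_one, Function.iterate_zero, id, Nat.add_sub_cancel, Nat.sub_zero]
      abel

/-- Unrolled, `leadingTerm D x z m` is `(ad D x)^m z` plus the sum over `j < m` of `(ad D x)^(m-1-j)
(ad x) (ad D x)^j (D z)`. Replacing `z` by `[D x, z]` shifts `j` by one, so only the `j = 0` term of
the next sum is missing. -/
theorem leadingTerm_lie {N : LieIdeal F L} (D : LieDerivation F L L) {x z : L}
    (hx : x ∈ N) (hz : z ∈ N) (m : ℕ) :
    leadingTerm D x ⁅D x, z⁆ m - leadingTerm D x z (m + 1) +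
      (LieAlgebra.ad F L (D x) ^ m) ⁅x, D z⁆ ∈ ⁅N, N⁆ := by
  induction m with
  | zero =>
    have h : ⁅D z, x⁆ + ⁅x, D z⁆ = 0 := by rw [← lie_skew]; abel
    simp [leadingTerm, h]
  | succ m ih =>
    have h := add_mem (lie_mem_right F L ⁅N, N⁆ (D x) _ ih) (LieSubmodule.lie_mem_lie hx
      (ad_pow_mem N (D x) m (lie_mem_right F L N (D (D x)) z hz)))
    have hA (v : L) : (LieAlgebra.ad F L (D x) ^ m) ⁅D x, v⁆ =
        ⁅D x, (LieAlgebra.ad F L (D x) ^ m) v⁆ := by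
      rw [← LieAlgebra.ad_apply (R := F), ← Module.End.mul_apply, ← pow_succ, pow_succ',
        Module.End.mul_apply, LieAlgebra.ad_apply]
    convert h using 1
    rw [leadingTerm, leadingTerm, LieDerivation.apply_lie_eq_add, map_add, lie_add,
      pow_succ']
    simp only [Module.End.mul_apply, LieAlgebra.ad_apply, lie_add, lie_sub, hA]
    abel

variable {N : LieIdeal F L} {n : ℕ} (hn : selfLcs N n = ⊥) (hF : ((n + 1).factorial : F) ≠ 0)
  (D : LieDerivation F L L) {x z : L} (hx : x ∈ N)
include hn hF hx

theorem leadingTerm_mem_lie (hz : z ∈ N) : leadingTerm D x z n ∈ ⁅N, N⁆ := by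
  have h := (iterate_apply_sub_leadingTerm_mem D hx hz n).2.1
  have h0 := ad_pow_mem_selfLcs hx hz n
  rw [hn, LieSubmodule.mem_bot] at h0
  rw [h0, iterate_map_zero, zero_sub] at h
  refine mem_of_natCast_nsmul_mem (n := n.factorial) (fun h0 => hF ?_) (by simpa using neg_mem h)
  rw [Nat.factorial_succ, Nat.cast_mul, h0, mul_zero]

theorem ad_pow_apply_mem (hz : z ∈ N) : (LieAlgebra.ad F L (D x) ^ n) (D z) ∈ N := by
  have h := (iterate_apply_sub_leadingTerm_mem D hx hz n).2.2
  have h0 := ad_pow_mem_selfLcs hx hz n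
  rw [hn, LieSubmodule.mem_bot] at h0
  rw [h0, iterate_map_zero, zero_sub] at h
  exact mem_of_natCast_nsmul_mem hF (by simpa using neg_mem h)

theorem ad_pow_lie_mem {w : L} (hw : w ∈ derivSup N D) :
    (LieAlgebra.ad F L (D x) ^ n) ⁅x, w⁆ ∈ ⁅N, N⁆ := by
  obtain ⟨a, ha, z, hz, rfl⟩ := mem_derivSup.1 hw
  rw [lie_add, map_add]
  refine add_mem (ad_pow_mem _ _ _ (LieSubmodule.lie_mem_lie hx ha)) ?_
  have h₁ := leadingTerm_lie D hx hz n
  have h₂ := leadingTerm_mem_lie hn hF D hx (lie_mem_right F L N (D x) z hz)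
  have h₃ : leadingTerm D x z (n + 1) ∈ ⁅N, N⁆ :=
    add_mem (lie_mem_right F L ⁅N, N⁆ _ _ (leadingTerm_mem_lie hn hF D hx hz))
      (LieSubmodule.lie_mem_lie hx (ad_pow_apply_mem hn hF D hx hz))
  simpa using sub_mem h₁ (sub_mem h₂ h₃)

/-- Applying `(ad D x)^n` to `leadingTerm D x z n` removes, modulo `[N, N]`, every summand
containing `ad x`, and leaves `(ad D x)^(2n) z`. -/
theorem ad_pow_add_self_mem (hz : z ∈ N) :
    (LieAlgebra.ad F L (D x) ^ (n + n)) z ∈ ⁅N, N⁆ := by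
  have key (m : ℕ) : (LieAlgebra.ad F L (D x) ^ n) (leadingTerm D x z m) -
      (LieAlgebra.ad F L (D x) ^ (n + m)) z ∈ ⁅N, N⁆ := by
    induction m with
    | zero => simp [leadingTerm]
    | succ m ih =>
      have hw := ad_pow_lie_mem hn hF D hx
        (ad_pow_mem (derivSup N D) (D x) m (apply_mem_derivSup D hz))
      convert add_mem (lie_mem_right F L ⁅N, N⁆ (D x) _ ih) hw using 1
      rw [leadingTerm, map_add, ← add_assoc n m 1, pow_succ' _ (n + m), Module.End.mul_apply,
        ← LieAlgebra.ad_apply (R := F), ← Module.End.mul_apply, ← pow_succ, pow_succ',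
        Module.End.mul_apply]
      simp only [LieAlgebra.ad_apply, lie_sub]
      abel
  simpa using sub_mem (ad_pow_mem ⁅N, N⁆ (D x) n (leadingTerm_mem_lie hn hF D hx hz)) (key n)

end Leibniz

/-! ### Derivation invariance of the nilradical -/

section Nilpotency

variable {F L : Type*} [Field F] [LieRing L] [LieAlgebra F L]

/-- Reduces `a + D x` to `D x`: for `a ∈ N`, `ad a` maps `N` into `[N, N]` and `L` into `N`. -/
theorem ad_add_pow_sub_mem {J K : LieIdeal F L} {a : L} (h : ∀ u ∈ J, ⁅a, u⁆ ∈ K) (y : L) {w : L}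
    (hw : w ∈ J) (k : ℕ) :
    (LieAlgebra.ad F L (a + y) ^ k) w - (LieAlgebra.ad F L y ^ k) w ∈ K := by
  induction k with
  | zero => simp
  | succ k ih =>
    convert add_mem (lie_mem_right F L K y _ ih) (h _ (ad_pow_mem J (a + y) k hw)) using 1
    simp only [pow_succ', Module.End.mul_apply, LieAlgebra.ad_apply, lie_sub, add_lie]
    abel

theorem lie_lie_selfLcs_le (N : LieIdeal F L) (i : ℕ) :
    ⁅⁅N, N⁆, selfLcs N i⁆ ≤ selfLcs N (i + 2) := by
  refine (LieSubmodule.lie_le_iff _ _ _).2 fun v hv c hc => ?_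
  rw [← LieSubmodule.mem_toSubmodule, LieSubmodule.lieIdeal_oper_eq_linear_span'] at hv
  induction hv using Submodule.span_induction with
  | mem w hw =>
    obtain ⟨a, ha, b, hb, rfl⟩ := hw
    rw [lie_lie]
    exact sub_mem (LieSubmodule.lie_mem_lie ha (LieSubmodule.lie_mem_lie hb hc))
      (LieSubmodule.lie_mem_lie hb (LieSubmodule.lie_mem_lie ha hc))
  | zero => simp
  | add x y _ _ hx hy => rw [add_lie]; exact add_mem hx hy
  | smul c x _ hx => rw [smul_lie]; exact SMulMemClass.smul_mem c hx

theorem ad_pow_lie (y a b : L) (n : ℕ) : (LieAlgebra.ad F L y ^ n) ⁅a, b⁆ =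
    ∑ i ∈ Finset.range (n + 1), n.choose i •
      ⁅(LieAlgebra.ad F L y ^ i) a, (LieAlgebra.ad F L y ^ (n - i)) b⁆ := by
  have h := (LieDerivation.ad F L y).iterate_apply_lie' n a b
  have hy : ⇑(LieDerivation.ad F L y) = ⇑(LieAlgebra.ad F L y) := funext fun v => by simp
  simpa only [Module.End.pow_apply, hy] using h

/-- A derivation `ad y` that maps some power of `N` into `⁅N, N⁆` is nilpotent on each factor of
the lower central series of `N`. -/
theorem exists_ad_pow_mem_selfLcs_succ {N : LieIdeal F L} {y : L} {k : ℕ}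
    (h : ∀ z ∈ N, (LieAlgebra.ad F L y ^ k) z ∈ ⁅N, N⁆) (i : ℕ) :
    ∃ l, ∀ z ∈ selfLcs N i, (LieAlgebra.ad F L y ^ l) z ∈ selfLcs N (i + 1) := by
  induction i with
  | zero => exact ⟨k, h⟩
  | succ i ih =>
    obtain ⟨l, hl⟩ := ih
    refine ⟨k + l, fun z hz => ?_⟩
    rw [selfLcs, ← LieSubmodule.mem_toSubmodule, LieSubmodule.lieIdeal_oper_eq_linear_span'] at hz
    induction hz using Submodule.span_induction with
    | mem w hw =>
      obtain ⟨a, ha, b, hb, rfl⟩ := hw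
      rw [ad_pow_lie]
      refine sum_mem fun j _ => nsmul_mem_lieIdeal _ ?_
      -- Of the `k + l` applications, at least `k` fall on `a` or at least `l` on `b`.
      rcases le_or_gt k j with hj | hj
      · exact lie_lie_selfLcs_le N i (LieSubmodule.lie_mem_lie
          (ad_pow_mem_of_le hj (h a ha)) (ad_pow_mem _ _ _ hb))
      · exact LieSubmodule.lie_mem_lie (ad_pow_mem _ _ _ ha)
          (ad_pow_mem_of_le (by lia) (hl b hb))
    | zero => simp
    | add x y _ _ hx hy => rw [map_add]; exact add_mem hx hy
    | smul c x _ hx => rw [map_smul]; exact SMulMemClass.smul_mem c hx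

theorem exists_ad_pow_mem_selfLcs {N : LieIdeal F L} {y : L} {k : ℕ}
    (h : ∀ z ∈ N, (LieAlgebra.ad F L y ^ k) z ∈ ⁅N, N⁆) (i : ℕ) :
    ∃ l, ∀ z ∈ N, (LieAlgebra.ad F L y ^ l) z ∈ selfLcs N i := by
  induction i with
  | zero => exact ⟨0, fun z hz => hz⟩
  | succ i ih =>
    obtain ⟨l, hl⟩ := ih
    obtain ⟨m, hm⟩ := exists_ad_pow_mem_selfLcs_succ h i
    refine ⟨m + l, fun z hz => ?_⟩
    rw [pow_add, Module.End.mul_apply]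
    exact hm _ (hl z hz)

/-- Engel's theorem, with the adjoint action computed in the ambient algebra. -/
theorem isNilpotent_of_forall_ad_pow [FiniteDimensional F L] {M : LieIdeal F L}
    (h : ∀ v ∈ M, ∃ k, ∀ w ∈ M, (LieAlgebra.ad F L v ^ k) w = 0) : LieRing.IsNilpotent M := by
  refine (LieAlgebra.isNilpotent_iff_forall (R := F)).2 fun v => ?_
  obtain ⟨k, hk⟩ := h v v.2
  refine ⟨k, LinearMap.ext fun w => Subtype.ext ?_⟩
  have hc (j : ℕ) : (((LieAlgebra.ad F M v ^ j) w : M) : L) =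
      (LieAlgebra.ad F L (v : L) ^ j) (w : L) := by
    induction j with
    | zero => simp
    | succ j ih => simp only [pow_succ', Module.End.mul_apply, LieAlgebra.ad_apply, ← ih]; rfl
  rw [hc, hk w w.2]
  rfl

/-- If `N` is a nilpotent ideal of class at most `n` and `(n + 1)!` is invertible, then `N + D(N)`
is a nilpotent ideal for every derivation `D`. -/
theorem isNilpotent_derivSup [FiniteDimensional F L] {N : LieIdeal F L} {n : ℕ}
    (hn : selfLcs N n = ⊥) (hF : ((n + 1).factorial : F) ≠ 0) (D : LieDerivation F L L) :
    LieRing.IsNilpotent (derivSup N D) := by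
  refine isNilpotent_of_forall_ad_pow fun v hv => ?_
  obtain ⟨a, ha, x, hx, rfl⟩ := mem_derivSup.1 hv
  have hNN : ∀ z ∈ N, (LieAlgebra.ad F L (a + D x) ^ (n + n)) z ∈ ⁅N, N⁆ := fun z hz => by
    simpa using add_mem (ad_add_pow_sub_mem (J := N) (K := ⁅N, N⁆)
      (fun u hu => LieSubmodule.lie_mem_lie ha hu) (D x) hz (n + n))
      (ad_pow_add_self_mem hn hF D hx hz)
  obtain ⟨l, hl⟩ := exists_ad_pow_mem_selfLcs hNN n
  -- `n` applications bring `N + D(N)` into `N`; `l` more kill `N`.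
  refine ⟨l + n, fun w hw => ?_⟩
  have hwN : (LieAlgebra.ad F L (a + D x) ^ n) w ∈ N := by
    obtain ⟨b, hb, z, hz, rfl⟩ := mem_derivSup.1 hw
    rw [map_add]
    refine add_mem (ad_pow_mem N _ n hb) ?_
    simpa using add_mem (ad_add_pow_sub_mem (J := ⊤) (K := N)
      (fun u _ => lie_mem_left F L N _ _ ha) (D x) (LieSubmodule.mem_top (D z)) n)
      (ad_pow_apply_mem hn hF D hx hz)
  have := hl _ hwN
  rwa [hn, LieSubmodule.mem_bot, ← Module.End.mul_apply, ← pow_add] at this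

theorem apply_mem_nilradical [FiniteDimensional F L]
    (hF : ((nilradicalClass F L + 1).factorial : F) ≠ 0) (D : LieDerivation F L L) {x : L}
    (hx : x ∈ nilradical F L) : D x ∈ nilradical F L := by
  have := isNilpotent_nilradical (F := F) (L := L)
  have hn : LieModule.lowerCentralSeries F (nilradical F L) (nilradical F L)
      (nilradicalClass F L) = ⊥ := by
    -- The nilpotency length is defined over `ℤ`; the lower central series over `ℤ` and `F` agree as
    -- sets.
    have h : LieModule.lowerCentralSeries ℤ (nilradical F L) (nilradical F L)
        (nilradicalClass F L) = ⊥ :=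
      Nat.sInf_mem (LieModule.IsNilpotent.nilpotent ℤ (nilradical F L) (nilradical F L))
    rw [SetLike.ext'_iff] at h ⊢
    simpa [LieModule.coe_lowerCentralSeries_eq_int F] using h
  exact le_nilradical (isNilpotent_derivSup (selfLcs_eq_bot hn) hF D) (apply_mem_derivSup D hx)

end Nilpotency

/-! ### Derivation invariance of the solvable radical -/

section Solvability

variable {F L : Type*} [Field F] [LieRing L] [LieAlgebra F L]

open LieAlgebra

theorem iterate_apply_smul (D : LieDerivation F L L) (j : ℕ) (c : F) (x : L) :
    D^[j] (c • x) = c • D^[j] x := by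
  rw [← LieDerivation.coeFn_coe, ← Module.End.pow_apply, map_smul, Module.End.pow_apply]

/-- The `k`-th derived term is spanned by brackets of `2 ^ k` elements of `N`; fewer copies of `D`
leave one untouched. -/
theorem iterate_apply_mem_of_mem_derivedSeriesOfIdeal (N : LieIdeal F L) (D : LieDerivation F L L)
    (k : ℕ) : ∀ w ∈ derivedSeriesOfIdeal F L k N, ∀ j < 2 ^ k, D^[j] w ∈ N := by
  induction k with
  | zero =>
    intro w hw j hj
    obtain rfl : j = 0 := by simpa using hj
    simpa using hw
  | succ k ih =>
    intro w hw j hj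
    rw [derivedSeriesOfIdeal_succ, ← LieSubmodule.mem_toSubmodule,
      LieSubmodule.lieIdeal_oper_eq_linear_span'] at hw
    induction hw using Submodule.span_induction with
    | mem w hw =>
      obtain ⟨a, ha, b, hb, rfl⟩ := hw
      rw [LieDerivation.iterate_apply_lie']
      refine sum_mem fun i hi => nsmul_mem_lieIdeal _ ?_
      rw [Finset.mem_range] at hi
      rw [pow_succ] at hj
      rcases lt_or_ge i (2 ^ k) with h | h
      · exact lie_mem_left F L N _ _ (ih a ha i h)
      · exact lie_mem_right F L N _ _ (ih b hb _ (by lia))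
    | zero => rw [iterate_map_zero]; exact N.zero_mem
    | add x y _ _ hx hy => rw [iterate_map_add]; exact add_mem hx hy
    | smul c x _ hx =>
      rw [iterate_apply_smul]
      exact N.smul_mem c hx

/-- Modulo `N`, only the middle Leibniz term of `D^[2 ^ (k + 1)] ⁅a', b'⁆` survives, since any other
puts fewer than `2 ^ k` copies on one side. Its binomial coefficient is then divided out. -/
theorem exists_of_mem_derivedSeriesOfIdeal_derivSup {N : LieIdeal F L} (D : LieDerivation F L L)
    (k : ℕ) (hF : ((2 ^ k).factorial : F) ≠ 0) :
    ∀ v ∈ derivedSeriesOfIdeal F L k (derivSup N D),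
      ∃ w ∈ derivedSeriesOfIdeal F L k N, v - D^[2 ^ k] w ∈ N := by
  induction k with
  | zero =>
    intro v hv
    obtain ⟨a, ha, b, hb, rfl⟩ := mem_derivSup.1 hv
    exact ⟨b, hb, by simpa using ha⟩
  | succ k ih =>
    have hk : ((2 ^ k).factorial : F) ≠ 0 := fun h => hF <| by
      obtain ⟨c, hc⟩ := Nat.factorial_dvd_factorial
        (Nat.pow_le_pow_right (n := 2) two_pos k.le_succ)
      rw [hc, Nat.cast_mul, h, zero_mul]
    have hch : (((2 ^ (k + 1)).choose (2 ^ k) : ℕ) : F) ≠ 0 := fun h => hF <| by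
      rw [← Nat.choose_mul_factorial_mul_factorial
        (Nat.pow_le_pow_right (n := 2) two_pos k.le_succ), Nat.cast_mul, Nat.cast_mul, h,
        zero_mul, zero_mul]
    specialize ih hk
    intro v hv
    rw [derivedSeriesOfIdeal_succ, ← LieSubmodule.mem_toSubmodule,
      LieSubmodule.lieIdeal_oper_eq_linear_span'] at hv
    induction hv using Submodule.span_induction with
    | mem v hv =>
      obtain ⟨a, ha, b, hb, rfl⟩ := hv
      obtain ⟨a', ha', haN⟩ := ih a ha
      obtain ⟨b', hb', hbN⟩ := ih b hb
      set c : F := (((2 ^ (k + 1)).choose (2 ^ k) : ℕ) : F) with hc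
      have hmem : ⁅a', b'⁆ ∈ derivedSeriesOfIdeal F L (k + 1) N := by
        rw [derivedSeriesOfIdeal_succ]
        exact LieSubmodule.lie_mem_lie ha' hb'
      refine ⟨c⁻¹ • ⁅a', b'⁆, SMulMemClass.smul_mem _ hmem, ?_⟩
      have hr : D^[2 ^ (k + 1)] ⁅a', b'⁆ - c • ⁅D^[2 ^ k] a', D^[2 ^ k] b'⁆ ∈ N := by
        have hmr : 2 ^ k ∈ Finset.range (2 ^ (k + 1) + 1) := by
          rw [Finset.mem_range, pow_succ]; lia
        rw [LieDerivation.iterate_apply_lie', ← Finset.sum_erase_add _ _ hmr, hc,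
          Nat.cast_smul_eq_nsmul]
        have h2 : 2 ^ (k + 1) - 2 ^ k = 2 ^ k := by rw [pow_succ]; lia
        rw [h2, add_sub_cancel_right]
        refine sum_mem fun i hi => nsmul_mem_lieIdeal _ ?_
        rw [Finset.mem_erase, Finset.mem_range] at hi
        rcases lt_or_ge i (2 ^ k) with h | h
        · exact lie_mem_left F L N _ _
            (iterate_apply_mem_of_mem_derivedSeriesOfIdeal N D k a' ha' i h)
        · refine lie_mem_right F L N _ _
            (iterate_apply_mem_of_mem_derivedSeriesOfIdeal N D k b' hb' _ ?_)
          have := hi.1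
          rw [pow_succ]
          lia
      have h1 := N.smul_mem c⁻¹ hr
      rw [smul_sub, smul_smul, inv_mul_cancel₀ hch, one_smul] at h1
      have h2 : ⁅a, b⁆ - ⁅D^[2 ^ k] a', D^[2 ^ k] b'⁆ ∈ N := by
        have := add_mem (lie_mem_left F L N _ b haN) (lie_mem_right F L N (D^[2 ^ k] a') _ hbN)
        simpa [sub_lie, lie_sub] using this
      rw [iterate_apply_smul]
      convert sub_mem h2 h1 using 1
      abel
    | zero => exact ⟨0, LieSubmodule.zero_mem _, by simp [iterate_map_zero]⟩
    | add x y _ _ hx hy =>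
      obtain ⟨x', hx', hxN⟩ := hx
      obtain ⟨y', hy', hyN⟩ := hy
      refine ⟨x' + y', add_mem hx' hy', ?_⟩
      rw [iterate_map_add, add_sub_add_comm]
      exact add_mem hxN hyN
    | smul c x _ hx =>
      obtain ⟨x', hx', hxN⟩ := hx
      refine ⟨c • x', SMulMemClass.smul_mem c hx', ?_⟩
      rw [iterate_apply_smul, ← smul_sub]
      exact N.smul_mem c hxN

/-- If `N` is a solvable ideal of derived length at most `d` and `(2 ^ d)!` is invertible, then
`N + D(N)` is a solvable ideal for every derivation `D`. -/
theorem isSolvable_derivSup {N : LieIdeal F L} {d : ℕ} (hd : derivedSeriesOfIdeal F L d N = ⊥)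
    (hF : ((2 ^ d).factorial : F) ≠ 0) (D : LieDerivation F L L) :
    IsSolvable (derivSup N D) := by
  have hle : derivedSeriesOfIdeal F L d (derivSup N D) ≤ N := fun v hv => by
    obtain ⟨w, hw, h⟩ := exists_of_mem_derivedSeriesOfIdeal_derivSup D d hF v hv
    rw [hd, LieSubmodule.mem_bot] at hw
    simpa [hw, iterate_map_zero] using h
  -- `d` derived steps lead into `N`, and `d` more reach zero.
  refine IsSolvable.mk (R := F) (k := d + d) ?_
  rw [LieIdeal.derivedSeries_eq_bot_iff, derivedSeriesOfIdeal_add, eq_bot_iff, ← hd]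
  exact derivedSeriesOfIdeal_mono hle d

theorem apply_mem_radical [FiniteDimensional F L]
    (hF : ((2 ^ radicalDerivedLength F L).factorial : F) ≠ 0) (D : LieDerivation F L L) {x : L}
    (hx : x ∈ radical F L) : D x ∈ radical F L := by
  have hd : derivedSeriesOfIdeal F L (radicalDerivedLength F L) (radical F L) = ⊥ := by
    rw [← LieIdeal.derivedSeries_eq_bot_iff]
    exact Nat.sInf_mem (IsSolvable.solvable F (radical F L))
  exact (LieIdeal.solvable_iff_le_radical F L _).1 (isSolvable_derivSup hd hF D)
    (apply_mem_derivSup D hx)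

end Solvability

/-! ### Derivation-invariant ideals and simplicity -/

section DerivationInvariant

variable {F L : Type*} [Field F] [LieRing L] [LieAlgebra F L]

open LieAlgebra

/-- The derivation of an ideal `I` induced by an element of the ambient algebra. -/
def adOnIdeal (I : LieIdeal F L) (l : L) : LieDerivation F I I where
  toLinearMap := LieModule.toEnd F L I l
  leibniz' a b := Subtype.ext <| by
    change ⁅l, ⁅(a : L), (b : L)⁆⁆ = ⁅(a : L), ⁅l, (b : L)⁆⁆ - ⁅(b : L), ⁅l, (a : L)⁆⁆
    rw [leibniz_lie, ← lie_skew (b : L)]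
    abel

/-- An ideal that is mapped into itself by all derivations. -/
def IsDerivationInvariant (K : LieIdeal F L) : Prop :=
  ∀ D : LieDerivation F L L, ∀ x ∈ K, D x ∈ K

theorem isDerivationInvariant_lie_self {K : LieIdeal F L}
    (h : ∀ D : LieDerivation F L L, ∀ x ∈ K, ∀ y ∈ K, D ⁅x, y⁆ ∈ ⁅K, K⁆) :
    IsDerivationInvariant ⁅K, K⁆ := by
  intro D x hx
  rw [← LieSubmodule.mem_toSubmodule, LieSubmodule.lieIdeal_oper_eq_linear_span'] at hx
  induction hx using Submodule.span_induction with
  | mem w hw =>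
    obtain ⟨a, ha, b, hb, rfl⟩ := hw
    exact h D a ha b hb
  | zero => rw [map_zero]; exact LieSubmodule.zero_mem _
  | add x y _ _ hx hy => rw [map_add]; exact add_mem hx hy
  | smul c x _ hx => rw [map_smul]; exact SMulMemClass.smul_mem c hx

theorem isDerivationInvariant_of_lie_self_eq {K : LieIdeal F L} (h : ⁅K, K⁆ = K) :
    IsDerivationInvariant K := by
  rw [← h]
  refine isDerivationInvariant_lie_self fun D x hx y hy => ?_
  rw [LieDerivation.apply_lie_eq_add, h]
  exact add_mem (lie_mem_left F L K _ _ hx) (lie_mem_right F L K _ _ hy)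

theorem eq_bot_or_eq_top_of_isDerivationInvariant {I : LieIdeal F L} (hI : IsAtom I)
    {K : LieIdeal F I} (hK : IsDerivationInvariant K) : K = ⊥ ∨ K = ⊤ := by
  let J : LieIdeal F L :=
    { toSubmodule := K.toSubmodule.map I.toSubmodule.subtype
      lie_mem := by
        rintro l _ ⟨a, ha, rfl⟩
        exact ⟨adOnIdeal I l a, hK _ a ha, rfl⟩ }
  have hJ (a : I) : (a : L) ∈ J ↔ a ∈ K :=
    ⟨fun ⟨b, hb, hba⟩ => Subtype.ext hba ▸ hb, fun h => ⟨a, h, rfl⟩⟩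
  have hJI : J ≤ I := by
    rintro _ ⟨a, -, rfl⟩
    exact a.2
  rcases hI.le_iff.1 hJI with h | h
  · refine .inl (eq_bot_iff.2 fun a ha => ?_)
    have := (hJ a).2 ha
    rw [h, LieSubmodule.mem_bot] at this
    exact (LieSubmodule.mem_bot a).2 (Subtype.ext this)
  · exact .inr (eq_top_iff.2 fun a _ => (hJ a).1 (h.ge a.2))

theorem lie_self_eq_bot_iff_isLieAbelian {K : LieIdeal F L} : ⁅K, K⁆ = ⊥ ↔ IsLieAbelian K :=
  (LieSubmodule.lie_abelian_iff_lie_self_eq_bot K).symm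

theorem isSimple_of_forall_not_isLieAbelian [FiniteDimensional F L] (hL : ¬ IsLieAbelian L)
    (hinv : ∀ K : LieIdeal F L, IsDerivationInvariant K → K = ⊥ ∨ K = ⊤)
    (hab : ∀ K : LieIdeal F L, IsLieAbelian K → K = ⊥) : IsSimple F L := by
  refine ⟨fun K => ?_, hL⟩
  rcases eq_bot_or_exists_atom_le K with h | ⟨J, hJ, hJK⟩
  · exact .inl h
  have hJJ : ⁅J, J⁆ = J := by
    refine (hJ.le_iff.1 (LieSubmodule.lie_le_right _ _)).resolve_left fun h => ?_
    exact hJ.1 (hab J (lie_self_eq_bot_iff_isLieAbelian.1 h))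
  have hJt := (hinv J (isDerivationInvariant_of_lie_self_eq hJJ)).resolve_left hJ.1
  exact .inr (top_le_iff.1 (hJt ▸ hJK))

/-- The derived algebra is derivation-invariant: if zero, `L` is abelian; if everything, the derived
series is constant. -/
theorem not_isSolvable_of_isDerivationInvariant (hL : ¬ IsLieAbelian L)
    (hinv : ∀ K : LieIdeal F L, IsDerivationInvariant K → K = ⊥ ∨ K = ⊤) : ¬ IsSolvable L := by
  intro hs
  have hd : IsDerivationInvariant ⁅(⊤ : LieIdeal F L), (⊤ : LieIdeal F L)⁆ :=
    isDerivationInvariant_lie_self fun D x _ y _ => by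
      rw [LieDerivation.apply_lie_eq_add]
      exact add_mem (LieSubmodule.lie_mem_lie (LieSubmodule.mem_top _) (LieSubmodule.mem_top _))
        (LieSubmodule.lie_mem_lie (LieSubmodule.mem_top _) (LieSubmodule.mem_top _))
  rcases hinv _ hd with h | h
  · refine hL ⟨fun x y => ?_⟩
    rw [← LieSubmodule.mem_bot (R := F) (L := L), ← h]
    exact LieSubmodule.lie_mem_lie (LieSubmodule.mem_top _) (LieSubmodule.mem_top _)
  · obtain ⟨k, hk⟩ := IsSolvable.solvable F L
    have htop := LieIdeal.derivedSeries_eq_top k h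
    refine hL ⟨fun x y => ?_⟩
    rw [← LieSubmodule.mem_bot (R := F) (L := L), ← hk, htop]
    exact LieSubmodule.mem_top _

/-- A regular Lie algebra that is not abelian and has no proper nonzero derivation-invariant ideal
is simple. -/
theorem isSimple_of_factorial_ne_zero [FiniteDimensional F L] (hL : ¬ IsLieAbelian L)
    (hinv : ∀ K : LieIdeal F L, IsDerivationInvariant K → K = ⊥ ∨ K = ⊤)
    (hF : ((nilradicalClass F L + 1).factorial : F) ≠ 0 ∨
      ((2 ^ radicalDerivedLength F L).factorial : F) ≠ 0) : IsSimple F L := by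
  have hs := not_isSolvable_of_isDerivationInvariant hL hinv
  have hns (K : LieIdeal F L) (hK : IsSolvable K) : K ≠ ⊤ := by
    rintro rfl
    exact hs ((solvable_iff_equiv_solvable LieIdeal.topEquiv).1 hK)
  refine isSimple_of_forall_not_isLieAbelian hL hinv fun K hK => ?_
  rcases hF with hF | hF
  · have hN := isNilpotent_nilradical (F := F) (L := L)
    have hb := (hinv _ fun D x hx => apply_mem_nilradical hF D hx).resolve_right
      (hns _ inferInstance)
    exact le_bot_iff.1 (hb ▸ le_nilradical (J := K) inferInstance)
  · have hb := (hinv _ fun D x hx => apply_mem_radical hF D hx).resolve_right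
      (hns _ inferInstance)
    exact le_bot_iff.1 (hb ▸ (LieIdeal.solvable_iff_le_radical F L K).1 inferInstance)

end DerivationInvariant

theorem natCast_factorial_ne_zero {F : Type*} [Field F] {p : ℕ} (hp : p.Prime) [CharP F p] {n : ℕ}
    (h : n < p) : (n.factorial : F) ≠ 0 := by
  rw [Ne, CharP.cast_eq_zero_iff F p, hp.dvd_factorial]
  lia

end RegularLie

theorem theoremt {F L : Type*} [Field F] [LieRing L] [LieAlgebra F L] [FiniteDimensional F L] :
    (∀ I : LieIdeal F L, IsAtom I → ¬ IsLieAbelian I →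
      LieAlgebra.IsSimple F I ∨
        ∃ p : ℕ, p.Prime ∧ CharP F p ∧
          p - 1 ≤ RegularLie.nilradicalClass F I ∧
          Real.logb 2 (p : ℝ) ≤ (RegularLie.radicalDerivedLength F I : ℝ)) ∧
    (∀ I : LieIdeal F L, IsAtom I →
      IsLieAbelian I ∨ LieAlgebra.IsSimple F I ∨ RegularLie.Irregular F I) := by
  have main (I : LieIdeal F L) (hI : IsAtom I) (hab : ¬ IsLieAbelian I) :
      LieAlgebra.IsSimple F I ∨
        ∃ p : ℕ, p.Prime ∧ CharP F p ∧
          p - 1 ≤ RegularLie.nilradicalClass F I ∧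
          Real.logb 2 (p : ℝ) ≤ (RegularLie.radicalDerivedLength F I : ℝ) := by
    -- If both factorials vanish in `F`, the characteristic is a prime `p` with `p ≤ n + 1` and `p ≤
    -- 2 ^ d`, which are the two bounds of case (ii).
    by_cases hF : ((RegularLie.nilradicalClass F I + 1).factorial : F) ≠ 0 ∨
        ((2 ^ RegularLie.radicalDerivedLength F I).factorial : F) ≠ 0
    · exact .inl (RegularLie.isSimple_of_factorial_ne_zero hab
        (fun K => RegularLie.eq_bot_or_eq_top_of_isDerivationInvariant hI) hF)
    push Not at hF
    obtain ⟨hN, hR⟩ := hF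
    obtain ⟨p, hp⟩ := CharP.exists F
    rcases CharP.char_is_prime_or_zero F p with hpp | rfl
    · refine .inr ⟨p, hpp, hp, ?_, ?_⟩
      · by_contra h
        exact RegularLie.natCast_factorial_ne_zero hpp (by lia) hN
      · by_contra! h
        rw [Real.lt_logb_iff_rpow_lt one_lt_two (by exact_mod_cast hpp.pos),
          Real.rpow_natCast] at h
        exact RegularLie.natCast_factorial_ne_zero hpp (by exact_mod_cast h) hR
    · have := CharP.charP_to_charZero F
      exact absurd hN (Nat.cast_ne_zero.2 (Nat.factorial_ne_zero _))
  refine ⟨main, fun I hI => ?_⟩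
  by_cases hab : IsLieAbelian I
  · exact .inl hab
  rcases main I hI hab with h | ⟨p, hp, hpF, hN, hR⟩
  · exact .inr (.inl h)
  refine .inr (.inr ?_)
  rintro ((h | ⟨q, -, hqF, hq⟩) | (h | ⟨q, -, hqF, hq⟩))
  · exact hp.ne_zero (CharP.eq F hpF (CharP.ofCharZero F))
  · obtain rfl := CharP.eq F hpF hqF
    exact hq.not_ge hN
  · exact hp.ne_zero (CharP.eq F hpF (CharP.ofCharZero F))
  · obtain rfl := CharP.eq F hpF hqF
    exact hq.not_ge hR
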